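/- Let $\Delta \ge 1$ be an odd integer. There exist a deterministic synchronous distributed algorithm $\mathcal{A}$, with finitely many local states and finitely many messages, and a constant $T$, both depending only on $\Delta$, such that the following holds for every finite simple graph $\mathcal{G} = (V,E)$ in which every node has degree at most $\Delta$, for every port numbering of $\mathcal{G}$ (each node $v$ numbers its incident edges by $1, 2, \dotsc, \deg(v)$), and for every orientation of $\mathcal{G}$ (for each edge $\{u,v\}$ exactly one of the directions $(u,v)$, $(v,u)$ is chosen). The nodes are anonymous and all run the same algorithm $\mathcal{A}$; initially a node knows only its degree and, for each of its ports, whether the edge at that port is outgoing or incoming. In each round every node sends a message through each of its ports, receives a message through each of its ports, and updates its state. After $T$ communication rounds each node has irrevocably decided whether it belongs to the output set $D$, and 1. $D$ is a dominating set of $\mathcal{G}$, i.e. each node is in $D$ or has a neighbour in $D$; 2. $|D| \le \Delta \cdot |D'|$ for every dominating set $D'$ of $\mathcal{G}$. That is, there is a local algorithm with approximation factor $\Delta$ for the minimum dominating set problem in port-numbered oriented graphs of maximum degree at most $\Delta$. -/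

import Mathlib

/-- A port numbering of `G`: every node `v` numbers its incident edges (equivalently, its
neighbours) with the ports `0, …, deg v - 1`. -/
structure PortNumbering {V : Type*} (G : SimpleGraph V) [G.LocallyFinite] where
  port : (v : V) → Fin (G.degree v) ≃ G.neighborSet v

/-- An orientation of `G`: for each edge `{u, v}` exactly one of the directions `(u, v)`, `(v, u)`
is chosen; `dir u v` says that the edge is directed from `u` to `v`. -/
structure EdgeOrientation {V : Type*} (G : SimpleGraph V) where
  dir : V → V → Prop
  adj_of_dir : ∀ u v, dir u v → G.Adj u v
  dir_or_dir : ∀ u v, G.Adj u v → dir u v ∨ dir v u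
  not_both : ∀ u v, dir u v → ¬ dir v u

/-- A deterministic synchronous distributed algorithm for anonymous port-numbered oriented networks,
with a one-bit output at each node. All nodes run the same algorithm; the sets of states and of
messages are finite, so that their sizes do not depend on the network.

* `init d out` is the initial state of a node of degree `d`, where `out i` says whether the edge at
  port `i` is outgoing (`true`) or incoming (`false`);
* `send d s i` is the message that a node of degree `d` in state `s` sends through port `i`;
* `receive d s m` is the next state of a node of degree `d` in state `s` that receives the message
  `m i` through each port `i`;
* `output s` is `none` if the node is still running, and `some b` if it has decided on the output
  `b`; a decision is never revoked. -/
structure DistributedAlgorithm where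
  State : Type
  Msg : Type
  finite_state : Finite State
  finite_msg : Finite Msg
  init : (d : ℕ) → (Fin d → Bool) → State
  send : (d : ℕ) → State → Fin d → Msg
  receive : (d : ℕ) → State → (Fin d → Msg) → State
  output : State → Option Bool
  output_final : ∀ (d : ℕ) (s : State) (m : Fin d → Msg) (b : Bool),
    output s = some b → output (receive d s m) = some b

namespace DistributedAlgorithm

variable {V : Type*} {G : SimpleGraph V} [G.LocallyFinite]

open Classical in
/-- The state of each node after `t` synchronous communication rounds. The message that `v`
receives through its port `i` is the one that the neighbour `u` behind that port sent through the
port of `u` that leads to `v`. -/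
noncomputable def run (A : DistributedAlgorithm) (P : PortNumbering G) (O : EdgeOrientation G) :
    ℕ → V → A.State
  | 0, v => A.init (G.degree v) (fun i => decide (O.dir v (P.port v i)))
  | t + 1, v => A.receive (G.degree v) (run A P O t v) (fun i =>
      A.send (G.degree (P.port v i : V)) (run A P O t (P.port v i))
        ((P.port (P.port v i : V)).symm ⟨v, G.adj_symm (P.port v i).2⟩))

/-- Within `T` communication rounds, every node has produced its output. -/
def CompletesIn (A : DistributedAlgorithm) (P : PortNumbering G) (O : EdgeOrientation G)
    (T : ℕ) : Prop :=
  ∀ v : V, (A.output (A.run P O T v)).isSome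

open Classical in
/-- The set of nodes whose output after `T` rounds is `true`. -/
noncomputable def selected [Fintype V] (A : DistributedAlgorithm) (P : PortNumbering G)
    (O : EdgeOrientation G) (T : ℕ) : Finset V :=
  Finset.univ.filter fun v => A.output (A.run P O T v) = some true

end DistributedAlgorithm

/-- `D` is a dominating set of `G`: every node is in `D` or has a neighbour in `D`. -/
def IsDominatingSet {V : Type*} (G : SimpleGraph V) (D : Finset V) : Prop :=
  ∀ v : V, v ∈ D ∨ ∃ u ∈ D, G.Adj v u

/-- `D` is an `α`-approximation of a minimum dominating set of `G`. -/
def IsApproxMinDominatingSet {V : Type*} (G : SimpleGraph V) (α : ℝ) (D : Finset V) : Prop :=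
  IsDominatingSet G D ∧ ∀ D' : Finset V, IsDominatingSet G D' → (D.card : ℝ) ≤ α * D'.card

/-!
If `D'` dominates `G`, then every node of `D` lies in the closed neighbourhood of a node of `D'`.
So `|D| ≤ Δ * |D'|` as soon as every closed neighbourhood contains at most `Δ` nodes of `D`, and
this can fail only at a node of degree exactly `Δ` whose whole closed neighbourhood lies in `D`
(`card_le_mul_of_closedNeighborhood`). It remains to construct, in constantly many rounds, a
dominating set that contains no closed neighbourhood of a node of degree `Δ`.

One round lets every node learn its *port colour*: for each of its ports, the direction of the edge
and the number of the port at the other end. A node `v` of odd degree `Δ` has a neighbour with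
another port colour (`exists_adj_portColor_ne`), as Naor and Stockmeyer observed: otherwise all
neighbours share one colour with `v`, and "the port at the other end" becomes an involution of the
`Δ` ports; it reverses the directions, hence has no fixed point, which is impossible as `Δ` is odd.

The nodes then go through the finitely many port colours in a fixed order; when the turn of its
colour comes, a node joins `D` unless a neighbour has joined before. The resulting `D` is dominating
(`exists_adj_greedy_of_not_greedy`), and adjacent members of `D` have equal colours
(`Greedy.eq_of_adj`), so a node of degree `Δ` and its neighbour of another colour are not both in `D`.
-/

/-! ### Greedy selection along a colouring -/

section Greedy

variable {V : Type*} (G : SimpleGraph V) (c : V → ℕ)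

/-- The nodes that have joined before step `t` of the greedy selection: in step `t`, the nodes of
colour `t` without a neighbour that has already joined do join. The colouring `c` need not be
proper, and nodes of the same colour decide simultaneously. -/
def GreedyBefore : ℕ → V → Prop
  | 0, _ => False
  | t + 1, v => GreedyBefore t v ∨ (c v = t ∧ ∀ u, G.Adj v u → ¬ GreedyBefore t u)

/-- The nodes that the greedy selection ever picks; a node of colour `t` can only join in
step `t`. -/
def Greedy (v : V) : Prop := GreedyBefore G c (c v + 1) v

variable {G c}

theorem greedyBefore_iff (t : ℕ) (v : V) : GreedyBefore G c t v ↔ c v < t ∧ Greedy G c v := by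
  induction t with
  | zero => simp [GreedyBefore]
  | succ t ih =>
    rcases lt_trichotomy (c v) t with h | h | h
    · simp [GreedyBefore, ih, h, h.ne, h.trans (Nat.lt_succ_self t)]
    · subst h; simp [Greedy]
    · simp [GreedyBefore, ih, h.ne', Nat.not_lt.2 h.le, Nat.not_lt.2 h]

theorem greedy_iff (v : V) :
    Greedy G c v ↔ ∀ u, G.Adj v u → c u < c v → ¬ Greedy G c u := by
  have h : ¬ GreedyBefore G c (c v) v := fun h => lt_irrefl _ ((greedyBefore_iff _ _).1 h).1
  rw [Greedy, GreedyBefore]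
  simp only [h, false_or, true_and, greedyBefore_iff, not_and]

theorem exists_adj_greedy_of_not_greedy {v : V} (h : ¬ Greedy G c v) :
    ∃ u, G.Adj v u ∧ Greedy G c u := by
  rw [greedy_iff] at h
  push Not at h
  obtain ⟨u, hu, -, hg⟩ := h
  exact ⟨u, hu, hg⟩

theorem Greedy.eq_of_adj {u v : V} (hu : Greedy G c u) (hv : Greedy G c v) (h : G.Adj u v) :
    c u = c v := by
  rcases lt_trichotomy (c u) (c v) with hlt | heq | hlt
  · exact absurd hu ((greedy_iff v).1 hv u h.symm hlt)
  · exact heq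
  · exact absurd hv ((greedy_iff u).1 hu v h hlt)

end Greedy

/-! ### Comparing dominating sets -/

/-- A set `D` of nodes that contains no closed neighbourhood of a node of the maximum degree `Δ`
has at most `Δ` members in each closed neighbourhood; a dominating set `D'` covers `D` by
`|D'|` closed neighbourhoods. -/
theorem card_le_mul_of_closedNeighborhood {V : Type*} {G : SimpleGraph V}
    [G.LocallyFinite] {Δ : ℕ} (hdeg : ∀ v, G.degree v ≤ Δ) {D : Finset V}
    (hD : ∀ v ∈ D, G.degree v = Δ → ∃ u, G.Adj v u ∧ u ∉ D)
    {D' : Finset V} (hD' : IsDominatingSet G D') : D.card ≤ Δ * D'.card := by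
  classical
  have hsub : D ⊆ D'.biUnion fun v => (insert v (G.neighborFinset v)).filter (· ∈ D) := by
    intro v hv
    simp only [Finset.mem_biUnion, Finset.mem_filter, Finset.mem_insert,
      SimpleGraph.mem_neighborFinset]
    rcases hD' v with h | ⟨u, hu, hadj⟩
    · exact ⟨v, h, Or.inl rfl, hv⟩
    · exact ⟨u, hu, Or.inr hadj.symm, hv⟩
  refine (Finset.card_le_card hsub).trans ?_
  rw [mul_comm]
  refine Finset.card_biUnion_le_card_mul _ _ _ fun v _ => ?_
  have hcard : (insert v (G.neighborFinset v)).card = G.degree v + 1 := by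
    rw [Finset.card_insert_of_notMem (by simp), SimpleGraph.card_neighborFinset_eq_degree]
  rcases (hdeg v).lt_or_eq with hlt | heq
  · have := Finset.card_filter_le (insert v (G.neighborFinset v)) (· ∈ D)
    omega
  · obtain ⟨u, hu, huD⟩ : ∃ u ∈ insert v (G.neighborFinset v), u ∉ D := by
      by_cases hv : v ∈ D
      · obtain ⟨u, hadj, hu⟩ := hD v hv heq
        exact ⟨u, by simp [hadj], hu⟩
      · exact ⟨v, by simp, hv⟩
    have : ((insert v (G.neighborFinset v)).filter (· ∈ D)).card
        < (insert v (G.neighborFinset v)).card :=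
      Finset.card_lt_card (Finset.filter_ssubset.2 ⟨u, hu, huD⟩)
    omega

/-! ### Port colours -/

/-- For each port, the direction of its edge (`true` if outgoing) and the number of the port at the
other end; `none` stands for the ports that are not in use. -/
abbrev PortColor (Δ : ℕ) : Type := Fin Δ → Option (Bool × Fin Δ)

/-- The number of port colours. -/
def numPortColors (Δ : ℕ) : ℕ := Fintype.card (PortColor Δ)

/-- The place of a port colour in a fixed enumeration of all port colours. -/
noncomputable def PortColor.index {Δ : ℕ} (L : PortColor Δ) : Fin (numPortColors Δ) :=
  Fintype.equivFin _ L

section PortColor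

variable {V : Type*} {G : SimpleGraph V} [G.LocallyFinite] (Δ : ℕ) [NeZero Δ]

/-- The port of the neighbour behind port `i` of `v` that leads back to `v`. -/
def PortNumbering.backPort (P : PortNumbering G) (v : V) (i : Fin (G.degree v)) :
    Fin (G.degree (P.port v i : V)) :=
  (P.port (P.port v i : V)).symm ⟨v, G.adj_symm (P.port v i).2⟩

open Classical in
/-- The port colour of a node. Port numbers are reduced modulo `Δ`, which has no effect in a graph
of maximum degree at most `Δ`. -/
noncomputable def portColor (P : PortNumbering G) (O : EdgeOrientation G) (v : V) : PortColor Δ :=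
  fun i => if h : (i : ℕ) < G.degree v then
    some (decide (O.dir v (P.port v ⟨i, h⟩)), Fin.ofNat Δ (P.backPort v ⟨i, h⟩)) else none

variable {Δ}

/-- The neighbour behind port `i` sees, at the port that leads back, the reversed direction and
the port number `i`. -/
theorem portColor_backPort {P : PortNumbering G} {O : EdgeOrientation G} {v : V}
    {i : Fin Δ} (hi : (i : ℕ) < G.degree v) {j : Fin Δ}
    (hj : (j : ℕ) = P.backPort v ⟨i, hi⟩) {b : Bool} {j' : Fin Δ}
    (hv : portColor Δ P O v i = some (b, j')) :
    portColor Δ P O (P.port v ⟨i, hi⟩ : V) j = some (!b, i) := by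
  classical
  obtain ⟨u, hu⟩ : ∃ u : V, u = P.port v ⟨i, hi⟩ := ⟨_, rfl⟩
  have hadj : G.Adj v u := hu ▸ (P.port v ⟨i, hi⟩).2
  have hj' : (j : ℕ) = (P.port u).symm ⟨v, hadj.symm⟩ := by subst hu; exact hj
  have hlt : (j : ℕ) < G.degree u := hj' ▸ ((P.port u).symm ⟨v, hadj.symm⟩).2
  have hport : P.port u ⟨j, hlt⟩ = ⟨v, hadj.symm⟩ :=
    ((P.port u).symm_apply_eq.1 (Fin.ext hj'.symm)).symm
  -- Stated for a variable `w` because the type of the ports of a node depends on the node.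
  have hback : ∀ w : G.neighborSet u, (w : V) = v →
      (((P.port w).symm ⟨u, G.adj_symm w.2⟩ : Fin _) : ℕ) = i := by
    rintro ⟨w, hw⟩ rfl
    have : (⟨u, G.adj_symm hw⟩ : G.neighborSet w) = P.port w ⟨i, hi⟩ := Subtype.ext hu
    simp only [this, Equiv.symm_apply_apply]
  have hdir : decide (O.dir u v) = !decide (O.dir v u) := by
    have h1 := O.dir_or_dir v u hadj
    have h2 := O.not_both v u
    by_cases h : O.dir v u <;> simp_all
  simp only [portColor, hi, dif_pos, Option.some.injEq, Prod.mk.injEq, ← hu] at hv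
  rw [← hu]
  simp only [portColor, hlt, dif_pos, Option.some.injEq, Prod.mk.injEq]
  refine ⟨?_, Fin.ext ?_⟩
  · rw [hport, ← hv.1]; exact hdir
  · have := hback (P.port u ⟨j, hlt⟩) (by rw [hport])
    simp only [PortNumbering.backPort, this, Fin.val_ofNat]
    exact Nat.mod_eq_of_lt i.2

/-- If `v` and all its neighbours had the same port colour, then "the port at the other end" would
be a fixed-point-free involution of the `Δ` ports of `v`. -/
theorem exists_adj_portColor_ne (hΔ : Odd Δ) (P : PortNumbering G) (O : EdgeOrientation G)
    (hdeg : ∀ v, G.degree v ≤ Δ) {v : V} (hv : G.degree v = Δ) :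
    ∃ u, G.Adj v u ∧ portColor Δ P O u ≠ portColor Δ P O v := by
  classical
  by_contra! hall
  have hi : ∀ i : Fin Δ, (i : ℕ) < G.degree v := fun i => hv ▸ i.2
  -- By `hv`, all `Δ` ports are in use; `f i` is the port at the other end of the edge at port `i`.
  let f : Fin Δ → Fin Δ := fun i => Fin.ofNat Δ (P.backPort v ⟨i, hi i⟩)
  let b : Fin Δ → Bool := fun i => decide (O.dir v (P.port v ⟨i, hi i⟩))
  have hL : ∀ i, portColor Δ P O v i = some (b i, f i) := fun i => by
    simp [portColor, hi i, b, f]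
  have hstep : ∀ i, b (f i) = !b i ∧ f (f i) = i := fun i => by
    have hfi : (f i : ℕ) = P.backPort v ⟨i, hi i⟩ := by
      simp only [f, Fin.val_ofNat]
      exact Nat.mod_eq_of_lt ((P.backPort v ⟨i, hi i⟩).2.trans_le (hdeg _))
    have h := portColor_backPort (hi i) hfi (hL i)
    rw [hall _ (P.port v ⟨i, hi i⟩).2, hL] at h
    simpa using h
  have heven : Even (Finset.univ : Finset (Fin Δ)).card :=
    -- Summing `1` over the ports in `ZMod 2`: the terms at `i` and `f i ≠ i` cancel.
    (ZMod.natCast_eq_zero_iff_even).1 <| by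
      rw [Finset.cast_card]
      refine Finset.sum_involution (fun i _ => f i) (fun _ _ => by decide) (fun i _ _ h => ?_)
        (fun _ _ => Finset.mem_univ _) (fun i _ => (hstep i).2)
      have := (hstep i).1
      rw [h] at this
      exact (Bool.eq_not_self _).1 this
  rw [Finset.card_univ, Fintype.card_fin] at heven
  exact Nat.not_even_iff_odd.2 hΔ heven

end PortColor

/-! ### The algorithm -/

section Algorithm

variable (Δ : ℕ) [NeZero Δ]

/-- A node first knows only the directions of its edges. After one round it knows its port colour;
it then stores this colour, the current step of the greedy selection, and whether it has joined.
Each message consists of the number of the port through which it is sent and of whether the sender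
has joined. A node decides once all port colours have been processed. -/
noncomputable def greedyAlgorithm : DistributedAlgorithm where
  State := (Fin Δ → Bool) ⊕ (PortColor Δ × Fin (numPortColors Δ + 1) × Bool)
  Msg := Fin Δ × Bool
  finite_state := inferInstance
  finite_msg := inferInstance
  init d out := .inl fun i => if h : (i : ℕ) < d then out ⟨i, h⟩ else false
  send _ s i := (Fin.ofNat Δ i, s.elim (fun _ => false) fun x => x.2.2)
  receive d s m := match s with
    | .inl out => .inr (fun i => if h : (i : ℕ) < d then some (out i, (m ⟨i, h⟩).1) else none,
        0, false)
    | .inr (L, t, b) => if h : (t : ℕ) < numPortColors Δ then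
        .inr (L, ⟨t + 1, Nat.succ_lt_succ h⟩,
          b || (decide ((L.index : ℕ) = t) && decide (∀ i, (m i).2 = false)))
      else .inr (L, t, b)
  output s := s.elim (fun _ => none) fun x =>
    if (x.2.1 : ℕ) < numPortColors Δ then none else some x.2.2
  output_final d s m b h := by
    rcases s with out | ⟨L, t, b'⟩
    · simp at h
    · by_cases ht : (t : ℕ) < numPortColors Δ
      · simp [ht] at h
      · simpa only [ht, dite_false] using h

variable {V : Type*} {G : SimpleGraph V} [G.LocallyFinite]

open Classical in
/-- The first round is spent on learning the port colour, so after `t + 1` rounds the first `t`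
steps of the greedy selection have been carried out. -/
theorem greedyAlgorithm_run (P : PortNumbering G) (O : EdgeOrientation G) (t : ℕ)
    (ht : t < numPortColors Δ + 1) (v : V) :
    (greedyAlgorithm Δ).run P O (t + 1) v = Sum.inr (portColor Δ P O v, ⟨t, ht⟩,
      decide (GreedyBefore G (fun v => ((portColor Δ P O v).index : ℕ)) t v)) := by
  induction t generalizing v with
  | zero =>
    have h0 : ¬ GreedyBefore G (fun v => ((portColor Δ P O v).index : ℕ)) 0 v := fun h => h
    rw [decide_eq_false h0]
    simp only [DistributedAlgorithm.run, greedyAlgorithm]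
    refine congrArg Sum.inr (Prod.ext (funext fun i => ?_) rfl)
    by_cases h : (i : ℕ) < G.degree v <;> simp [portColor, PortNumbering.backPort, h]
  | succ t ih =>
    have ht' : t < numPortColors Δ := Nat.lt_of_succ_lt_succ ht
    rw [DistributedAlgorithm.run]
    simp only [ih (ht'.trans (Nat.lt_succ_self _))]
    -- Quantifying over the ports of `v` is quantifying over its neighbours.
    have hports : ∀ p : V → Prop, (∀ i, p (P.port v i)) ↔ ∀ u, G.Adj v u → p u := fun p =>
      ⟨fun h u hu => by simpa using h ((P.port v).symm ⟨u, hu⟩), fun h i => h _ (P.port v i).2⟩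
    simp only [greedyAlgorithm, ht', dif_pos, Sum.elim_inr, decide_eq_false_iff_not, GreedyBefore,
      hports fun u => ¬ GreedyBefore G (fun v => ((portColor Δ P O v).index : ℕ)) t u,
      ← Bool.decide_and, ← Bool.decide_or]
    congr

theorem greedyAlgorithm_output (P : PortNumbering G) (O : EdgeOrientation G) (v : V) :
    ∃ b, (greedyAlgorithm Δ).output
      ((greedyAlgorithm Δ).run P O (numPortColors Δ + 1) v) = some b ∧
      (b = true ↔ Greedy G (fun v => ((portColor Δ P O v).index : ℕ)) v) := by
  classical
  refine ⟨decide (GreedyBefore G (fun v => ((portColor Δ P O v).index : ℕ)) (numPortColors Δ) v),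
    by rw [greedyAlgorithm_run Δ P O _ (Nat.lt_succ_self _)]; simp [greedyAlgorithm], ?_⟩
  rw [decide_eq_true_iff, greedyBefore_iff]
  exact and_iff_right (portColor Δ P O v).index.2

theorem mem_selected_greedyAlgorithm [Fintype V] (P : PortNumbering G) (O : EdgeOrientation G)
    (v : V) : v ∈ (greedyAlgorithm Δ).selected P O (numPortColors Δ + 1) ↔
      Greedy G (fun v => ((portColor Δ P O v).index : ℕ)) v := by
  obtain ⟨b, hb, hg⟩ := greedyAlgorithm_output Δ P O v
  simp [DistributedAlgorithm.selected, hb, hg]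

end Algorithm

theorem mainTheorem6 (Δ : ℕ) (hΔ : Odd Δ) :
    ∃ (A : DistributedAlgorithm) (T : ℕ),
      ∀ (V : Type*) [Fintype V] (G : SimpleGraph V) [G.LocallyFinite]
        (P : PortNumbering G) (O : EdgeOrientation G),
        (∀ v : V, G.degree v ≤ Δ) →
          A.CompletesIn P O T ∧ IsApproxMinDominatingSet G (Δ : ℝ) (A.selected P O T) := by
  have : NeZero Δ := ⟨hΔ.pos.ne'⟩
  refine ⟨greedyAlgorithm Δ, numPortColors Δ + 1, fun V _ G _ P O hdeg =>
    ⟨fun v => ?_, fun v => ?_, fun D' hD' => ?_⟩⟩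
  · obtain ⟨b, hb, -⟩ := greedyAlgorithm_output Δ P O v
    simp [hb]
  · simp only [mem_selected_greedyAlgorithm]
    by_cases h : Greedy G (fun v => ((portColor Δ P O v).index : ℕ)) v
    · exact Or.inl h
    · obtain ⟨u, hadj, hu⟩ := exists_adj_greedy_of_not_greedy h
      exact Or.inr ⟨u, hu, hadj⟩
  · refine mod_cast card_le_mul_of_closedNeighborhood hdeg (fun v hv hvΔ => ?_) hD'
    obtain ⟨u, hadj, hne⟩ := exists_adj_portColor_ne hΔ P O hdeg hvΔ
    refine ⟨u, hadj, fun hu => hne ?_⟩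
    rw [mem_selected_greedyAlgorithm] at hu hv
    exact (Fintype.equivFin _).injective (Fin.ext (hu.eq_of_adj hv hadj.symm))
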